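/- An index coding problem (ICP) has a finite set of files, each of $F$ bits, and users, each of which wants some of the files and knows some others. The server broadcasts a message of $\ell$ bits, a function of all files, from which each user must recover without error the files it wants, using the files it knows. The optimal rate $R^*$ is the minimum (infimum) of $\ell/F$, the transmission size in units of one file, over all file sizes and all (possibly nonlinear) codes. Let $i,L\ge 1$ be integers, let $a_1,\dots,a_i\ge 0$ be integers and let $K=(i-1)L+\sum_{j=1}^{i}a_j+1$. The $\overline{(a_i,a_{i-1},\dots,a_1)}_L$-ICP has $K$ users and $iK$ files $x_{b,p}$ with $b\in\mathbb{Z}/K\mathbb{Z}$ and $1\le p\le i$. User $k\in\mathbb{Z}/K\mathbb{Z}$ wants $x_{k,1},\dots,x_{k,i}$ and knows precisely the files $x_{b,p}$ with $1\le p\le i$ and $$b\equiv k+\sum_{j=1}^{v}a_{p-j}+(v-1)L+r \pmod K$$ for some $1\le v\le i-1$ and $1\le r\le L$, where the indices of the $a$'s are read modulo $i$. (It is the union, over disjoint sets of files, of the $(a_i,\dots,a_1)_L$-ICP, i.e. the column $p=1$, and its $i-1$ clockwise rotations.) Then: 1. If $a_1=\dots=a_{i-1}=0$, i.e. for the $\overline{(a_i,0,\dots,0)}_L$-ICP,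 the optimal rate is $R^*=K-(i-1)L+i-1$. 2. If $L=1$, i.e. for any $\overline{(a_i,\dots,a_1)}_1$-ICP, the optimal rate is $R^*=K$. Moreover, in both cases, for all sufficiently large file sizes $F$, the number $R^*$ is attained and is the exact minimum of $\ell/F$ over all codes for files of $F$ bits. -/

import Mathlib

open Filter

/-- An index coding problem with users `U` and files `X`: every user `k` wants the files in
`want k` and has the files in `known k`, none of which it wants, as side information. -/
structure IndexCodingProblem (U X : Type*) where
  /-- the want-set of each user -/
  want : U → Set X
  /-- the known-set (side information) of each user -/
  known : U → Set X
  known_subset : ∀ k, known k ⊆ (want k)ᶜ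

namespace IndexCodingProblem

/-- There is a (possibly nonlinear) zero-error code for files of `F` bits each in which the server
broadcasts `ℓ` bits: an encoder of the contents of all files, and for every user a decoder which
recovers the contents of the wanted files from the broadcast message and the known files. -/
def HasCode {U X : Type*} (P : IndexCodingProblem U X) (F ℓ : ℕ) : Prop :=
  ∃ (enc : (X → Fin F → Bool) → (Fin ℓ → Bool))
    (dec : ∀ k : U, (Fin ℓ → Bool) → (P.known k → Fin F → Bool) → (P.want k → Fin F → Bool)),
    ∀ (x : X → Fin F → Bool) (k : U), dec k (enc x) (fun y => x y.1) = fun y => x y.1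

/-- The transmission sizes that are achievable for files of `F` bits each, in units of one file
(i.e. of `F` bits). -/
def achievableRates {U X : Type*} (P : IndexCodingProblem U X) (F : ℕ) : Set ℝ :=
  {ρ | ∃ ℓ : ℕ, P.HasCode F ℓ ∧ ρ = (ℓ : ℝ) / F}

/-- The optimal transmission rate: the infimum of the transmission sizes, in units of one file,
over all file sizes `F ≥ 1` and all codes. -/
noncomputable def optimalRate {U X : Type*} (P : IndexCodingProblem U X) : ℝ :=
  sInf {ρ | ∃ F : ℕ, 1 ≤ F ∧ ρ ∈ P.achievableRates F}

/-- The union of a family of index coding problems with the same users and with no common files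
across the instances. The file `(p, x)` is the file `x` of instance `p`. -/
def union {ι U X : Type*} (P : ι → IndexCodingProblem U X) : IndexCodingProblem U (ι × X) where
  want k := {y | y.2 ∈ (P y.1).want k}
  known k := {y | y.2 ∈ (P y.1).known k}
  known_subset k y hy := (P y.1).known_subset k hy

/-- Vectors `(a_i, a_{i-1}, …, a_1)` are functions `a : ZMod i → ℕ`, where `a_j` is the value at
the residue class of `j`; in particular `a_i = a 0`.

`knownOffsets i L a` is the set of all positions, relative to a user, of the files that this user
knows: after `a_i` interfering files come `L` known ones, then after `a_{i-1}` interfering files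
again `L` known ones, and so on, in `i - 1` chunks. -/
def knownOffsets (i L : ℕ) (a : ZMod i → ℕ) : Set ℕ :=
  {m | ∃ v ∈ Finset.Icc 1 (i - 1), ∃ r ∈ Finset.Icc 1 L,
    m = ∑ j ∈ Finset.Icc 1 v, a (1 - (j : ZMod i)) + (v - 1) * L + r}

theorem knownOffsets_bounds {i L : ℕ} [NeZero i] {a : ZMod i → ℕ} {m : ℕ}
    (hm : m ∈ knownOffsets i L a) : 0 < m ∧ m ≤ (i - 1) * L + ∑ j, a j := by
  obtain ⟨v, hv, r, hr, rfl⟩ := hm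
  rw [Finset.mem_Icc] at hv hr
  have hinj : Set.InjOn (fun j : ℕ => (1 - (j : ZMod i))) (Finset.Icc 1 v) := by
    intro x hx y hy hxy
    simp only [Finset.coe_Icc, Set.mem_Icc] at hx hy
    have h1 : (x : ZMod i) = y := by simpa using hxy
    rw [ZMod.natCast_eq_natCast_iff'] at h1
    rwa [Nat.mod_eq_of_lt (by omega), Nat.mod_eq_of_lt (by omega)] at h1
  have h2 : ∑ j ∈ Finset.Icc 1 v, a (1 - (j : ZMod i)) ≤ ∑ j, a j := by
    rw [← Finset.sum_image (f := a) hinj]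
    exact Finset.sum_le_sum_of_subset (Finset.subset_univ _)
  have h3 : (v - 1) * L + r ≤ (i - 1) * L := by
    calc (v - 1) * L + r ≤ (v - 1) * L + L := by omega
      _ = (v - 1 + 1) * L := by ring
      _ ≤ (i - 1) * L := Nat.mul_le_mul_right _ (by omega)
  omega

/-- The `(a_i, a_{i-1}, …, a_1)_L` index coding problem with `K = (i-1)L + ∑ a_j + 1` users:
users and files are indexed by the residues modulo `K`, user `k` wants the file `k` and knows the
files at the positions `knownOffsets` after `k` in the cyclic order. -/
def symmetric (i L K : ℕ) [NeZero i] (a : ZMod i → ℕ) (hK : (i - 1) * L + ∑ j, a j + 1 = K) :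
    IndexCodingProblem (ZMod K) (ZMod K) where
  want k := {k}
  known k := {b | ∃ m ∈ knownOffsets i L a, b = k + (m : ZMod K)}
  known_subset := by
    rintro k b ⟨m, hm, rfl⟩ hb
    obtain ⟨h0, h1⟩ := knownOffsets_bounds hm
    have h2 : (m : ZMod K) = 0 := by simpa using hb
    rw [ZMod.natCast_eq_zero_iff] at h2
    have := Nat.le_of_dvd h0 h2
    omega

/-- The `s`-fold clockwise rotation of the vector `(a_i, a_{i-1}, …, a_1)`; for `s = 1` it is
`(a_1, a_i, …, a_2)`. -/
def rotate {i : ℕ} (a : ZMod i → ℕ) (s : ZMod i) : ZMod i → ℕ := fun j => a (j + s)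

theorem sum_rotate {i : ℕ} [NeZero i] (a : ZMod i → ℕ) (s : ZMod i) :
    ∑ j, rotate a s j = ∑ j, a j :=
  Fintype.sum_equiv (Equiv.addRight s) _ _ fun _ => rfl

/-- The `\overline{(a_i, a_{i-1}, …, a_1)}_L` index coding problem: the union of the
`(a_i, a_{i-1}, …, a_1)_L` problem and its `i - 1` clockwise rotations. The file `(p, b)` is the
`p`-th file requested by user `b`, and column `p` is the rotation by `p - 1`. -/
def cyclicUnion (i L K : ℕ) [NeZero i] (a : ZMod i → ℕ)
    (hK : (i - 1) * L + ∑ j, a j + 1 = K) : IndexCodingProblem (ZMod K) (ZMod i × ZMod K) :=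
  union fun p => symmetric i L K (rotate a (p - 1)) (by rw [sum_rotate]; exact hK)

end IndexCodingProblem

/-! Both claimed rates equal `∑ j, a j + i`, so one lower bound serves both cases. It comes from a
set of files with no decoding cycle: `a (p - 1) + 1` consecutive rows in each column `p`
(`le_of_hasCode_cyclicUnion`, via `HasCode.card_mul_le`).

The upper bounds are scalar linear codes over the field with `2 ^ F` elements. If only `a 0` is
nonzero, column `p` is shifted by `(p - 1)L`. The interference of all columns then falls on the same
`a 0` points, while the `i` wanted files sit at distinct points outside them. Thus at most `a 0 + i`
points matter to a user, and `a 0 + i` Vandermonde symbols resolve them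
(`eq_zero_of_forall_sum_mul_pow`). If `L = 1`, partial sums of `a j + 1` partition the files into
`K` cliques, and one sum per clique suffices. -/

namespace IndexCodingProblem

/-! ### Linear codes, the acyclic-set bound and the optimal rate -/

section General

variable {U X : Type*} (P : IndexCodingProblem U X)

/-- An encoder whose output, together with the side information of any user, separates the wanted
files of that user can be completed to a code. -/
theorem hasCode_of_separates {F ℓ : ℕ} (enc : (X → Fin F → Bool) → (Fin ℓ → Bool))
    (h : ∀ k x x', enc x = enc x' → (∀ y ∈ P.known k, x y = x' y) →
      ∀ y ∈ P.want k, x y = x' y) : P.HasCode F ℓ := by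
  classical
  refine ⟨enc, fun k m s => if hx : ∃ x, enc x = m ∧ ∀ y : P.known k, x y.1 = s y then
    fun y => hx.choose y.1 else fun _ _ => false, fun x k => ?_⟩
  have hx : ∃ x', enc x' = enc x ∧ ∀ y : P.known k, x' y.1 = x y.1 := ⟨x, rfl, fun _ => rfl⟩
  funext y
  dsimp only
  rw [dif_pos hx]
  exact h k _ x hx.choose_spec.1 (fun y hy => hx.choose_spec.2 ⟨y, hy⟩) y.1 y.2

/-- Scalar linear codes: the file `y` is sent along the vector `v y`. -/
theorem hasCode_of_linear [Fintype X] {𝔽 ι : Type*} [Field 𝔽] [Fintype ι] {F : ℕ}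
    (hF : Nat.card 𝔽 = 2 ^ F) (v : X → ι → 𝔽)
    (h : ∀ k (z : X → 𝔽), (∀ y ∈ P.known k, z y = 0) → (∀ j, ∑ y, z y * v y j = 0) →
      ∀ y ∈ P.want k, z y = 0) : P.HasCode F (Fintype.card ι * F) := by
  classical
  have : Finite 𝔽 := Nat.finite_of_card_ne_zero (by rw [hF]; positivity)
  have : Fintype 𝔽 := Fintype.ofFinite 𝔽
  rw [Nat.card_eq_fintype_card] at hF
  let e : (Fin F → Bool) ≃ 𝔽 := Fintype.equivOfCardEq (by simp [hF])
  let g : (ι → 𝔽) ≃ (Fin (Fintype.card ι * F) → Bool) :=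
    Fintype.equivOfCardEq (by simp [hF, ← pow_mul, mul_comm])
  refine P.hasCode_of_separates (fun x => g fun j => ∑ y, e (x y) * v y j)
    fun k x x' hxx hk y hy => e.injective ?_
  have hxx := congrFun (g.injective hxx)
  refine sub_eq_zero.1 (h k (fun y => e (x y) - e (x' y)) (fun y hy => ?_) (fun j => ?_) y hy)
  · rw [hk y hy, sub_self]
  · simp only [sub_mul, Finset.sum_sub_distrib]
    exact sub_eq_zero.2 (hxx j)

/-- The acyclic-set bound: if the files of `S` can be ranked such that, among the files of `S`,
some user wanting `y` only knows files of smaller rank than `y`, then the message is at least as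
long as the files of `S` together. -/
theorem HasCode.card_mul_le {P : IndexCodingProblem U X} {F ℓ : ℕ} (hP : P.HasCode F ℓ)
    (S : Finset X) (rank : X → ℕ) (u : X → U) (hu : ∀ y ∈ S, y ∈ P.want (u y))
    (hS : ∀ y ∈ S, ∀ y' ∈ S, y' ∈ P.known (u y) → rank y' < rank y) : S.card * F ≤ ℓ := by
  classical
  obtain ⟨enc, dec, hdec⟩ := hP
  -- Files outside `S` are frozen, so the message alone must determine those in `S`, decoded in
  -- order of rank.
  let ext : (S → Fin F → Bool) → X → Fin F → Bool :=
    fun s y => if hy : y ∈ S then s ⟨y, hy⟩ else fun _ => false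
  have hinj : Function.Injective fun s => enc (ext s) := by
    intro s s' hss
    have key : ∀ n, ∀ y ∈ S, rank y = n → ext s y = ext s' y := by
      intro n
      induction n using Nat.strong_induction_on with
      | _ n ih =>
        intro y hy hn
        have h1 := hdec (ext s) (u y)
        rw [show enc (ext s) = enc (ext s') from hss,
          show (fun y' : P.known (u y) => ext s y'.1) = fun y' => ext s' y'.1 from ?_,
          hdec (ext s') (u y)] at h1
        · exact (congrFun h1 ⟨y, hu y hy⟩).symm
        · funext y'
          by_cases hy' : y'.1 ∈ S
          · exact ih _ (hn ▸ hS y hy y'.1 hy' y'.2) _ hy' rfl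
          · simp only [ext, dif_neg hy']
    funext y
    simpa [ext] using key _ y.1 y.2 rfl
  have := Fintype.card_le_of_injective _ hinj
  simp only [Fintype.card_fun, Fintype.card_bool, Fintype.card_fin, Fintype.card_coe,
    ← pow_mul] at this
  rw [mul_comm]
  exact (Nat.pow_le_pow_iff_right (by norm_num)).1 this

/-- A lower bound on the message length which is attained for all large file sizes is the optimal
rate. -/
theorem optimalRate_eq_of_bounds {R : ℕ} (hlow : ∀ F ℓ, P.HasCode F ℓ → R * F ≤ ℓ)
    (hup : ∀ᶠ F in atTop, P.HasCode F (R * F)) :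
    P.optimalRate = R ∧ ∀ᶠ F : ℕ in atTop, IsLeast (P.achievableRates F) (R : ℝ) := by
  have hbd : ∀ F, 1 ≤ F → ∀ ρ ∈ P.achievableRates F, (R : ℝ) ≤ ρ := by
    rintro F hF ρ ⟨ℓ, hℓ, rfl⟩
    rw [le_div_iff₀ (by exact_mod_cast hF)]
    exact_mod_cast hlow F ℓ hℓ
  have hev : ∀ᶠ F : ℕ in atTop, 1 ≤ F ∧ IsLeast (P.achievableRates F) (R : ℝ) := by
    filter_upwards [hup, eventually_ge_atTop 1] with F hF h1
    refine ⟨h1, ⟨R * F, hF, ?_⟩, hbd F h1⟩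
    have : (F : ℝ) ≠ 0 := by positivity
    push_cast
    field_simp
  refine ⟨?_, hev.mono fun F h => h.2⟩
  obtain ⟨F, h1, hF⟩ := hev.exists
  exact IsLeast.csInf_eq ⟨⟨F, h1, hF.1⟩, fun ρ ⟨F', h', hρ⟩ => hbd F' h' ρ hρ⟩

end General

/-- A code word of the dual of a Reed–Solomon code of dimension `R` whose support lies in a set of
at most `R` points is zero. -/
theorem eq_zero_of_forall_sum_mul_pow {𝔽 C : Type*} [Field 𝔽] [Fintype C] {R : ℕ} (α : C → 𝔽)
    (hα : Function.Injective α) (w : C → 𝔽) (S : Finset C) (hS : S.card ≤ R)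
    (hw : ∀ c ∉ S, w c = 0) (h : ∀ j < R, ∑ c, w c * α c ^ j = 0) : w = 0 := by
  classical
  have hpoly : ∀ f : Polynomial 𝔽, f.natDegree < R → ∑ c, w c * f.eval (α c) = 0 := by
    intro f hf
    simp only [Polynomial.eval_eq_sum_range, Finset.mul_sum]
    rw [Finset.sum_comm]
    refine Finset.sum_eq_zero fun j hj => ?_
    have hj' : j < R := by have := Finset.mem_range.1 hj; omega
    calc ∑ c, w c * (f.coeff j * α c ^ j) = f.coeff j * ∑ c, w c * α c ^ j := by
          rw [Finset.mul_sum]; exact Finset.sum_congr rfl fun _ _ => by ring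
      _ = 0 := by rw [h j hj', mul_zero]
  funext c
  by_cases hc : c ∈ S
  swap
  · exact hw c hc
  -- This polynomial has degree `S.card - 1 < R` and vanishes on the rest of `S`; off `S` the word
  -- vanishes, so only the term at `c` survives.
  have h0 := hpoly (∏ s ∈ S.erase c, (Polynomial.X - Polynomial.C (α s))) (by
    rw [Polynomial.natDegree_finsetProd_X_sub_C_eq_card, Finset.card_erase_of_mem hc]
    have := Finset.card_pos.2 ⟨c, hc⟩
    omega)
  simp only [Polynomial.eval_prod, Polynomial.eval_sub, Polynomial.eval_X, Polynomial.eval_C] at h0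
  rw [Finset.sum_eq_single c] at h0
  · refine (mul_eq_zero.1 h0).resolve_right (Finset.prod_ne_zero_iff.2 fun s hs => ?_)
    exact sub_ne_zero.2 fun he => (Finset.mem_erase.1 hs).1 (hα he).symm
  · intro d _ hd
    by_cases hdS : d ∈ S
    · rw [Finset.prod_eq_zero (Finset.mem_erase.2 ⟨hd, hdS⟩) (sub_self _), mul_zero]
    · rw [hw d hdS, zero_mul]
  · simp

/-! ### The lower bound for the cyclic union -/

theorem lt_of_mem_knownOffsets {i L m : ℕ} {b : ZMod i → ℕ} (hm : m ∈ knownOffsets i L b) :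
    b 0 < m := by
  obtain ⟨v, hv, r, hr, rfl⟩ := hm
  rw [Finset.mem_Icc] at hv hr
  have : b (1 - ((1 : ℕ) : ZMod i)) ≤ ∑ j ∈ Finset.Icc 1 v, b (1 - (j : ZMod i)) :=
    Finset.single_le_sum (f := fun j : ℕ => b (1 - (j : ZMod i))) (fun _ _ => Nat.zero_le _)
      (Finset.mem_Icc.2 ⟨le_rfl, hv.1⟩)
  simp only [Nat.cast_one, sub_self] at this
  omega

/-- In every column, the wanted file of user `0` together with the first chunk of interfering files
gives an acyclic set. -/
theorem le_of_hasCode_cyclicUnion {i L K : ℕ} [NeZero i] {a : ZMod i → ℕ}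
    (hK : (i - 1) * L + ∑ j, a j + 1 = K) {F ℓ : ℕ}
    (h : (cyclicUnion i L K a hK).HasCode F ℓ) :
    (∑ j, a j + i) * F ≤ ℓ := by
  have hK0 : NeZero K := ⟨by omega⟩
  have hlt : ∀ p, a p < K := fun p => by
    have := Finset.single_le_sum (f := a) (fun _ _ => Nat.zero_le _) (Finset.mem_univ p)
    omega
  let S : Finset (ZMod i × ZMod K) :=
    (Finset.univ.sigma fun p : ZMod i => Finset.range (a (p - 1) + 1)).image
      fun y => (y.1, (y.2 : ZMod K))
  have hmem : ∀ y ∈ S, y.2.val ≤ a (y.1 - 1) := by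
    intro y hy
    obtain ⟨z, hz, rfl⟩ := Finset.mem_image.1 hy
    have := Finset.mem_range.1 (Finset.mem_sigma.1 hz).2
    have := hlt (z.1 - 1)
    change (z.2 : ZMod K).val ≤ a (z.1 - 1)
    rw [ZMod.val_natCast_of_lt (by omega)]
    omega
  have hcard : S.card = ∑ j, a j + i := by
    rw [Finset.card_image_of_injOn, Finset.card_sigma]
    · simp only [Finset.card_range, Finset.sum_add_distrib, Finset.sum_const, Finset.card_univ,
        ZMod.card, smul_eq_mul, mul_one, Nat.add_right_cancel_iff]
      exact Fintype.sum_equiv (Equiv.subRight 1) _ _ fun _ => rfl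
    · rintro ⟨p, m⟩ hy ⟨p', m'⟩ hy' he
      have h1 := Finset.mem_range.1 (Finset.mem_sigma.1 hy).2
      have h2 := Finset.mem_range.1 (Finset.mem_sigma.1 hy').2
      obtain ⟨rfl, he⟩ := Prod.mk.inj he
      have := hlt (p - 1)
      dsimp only at h1 h2 he
      have he := congrArg ZMod.val he
      rw [ZMod.val_natCast_of_lt (by omega), ZMod.val_natCast_of_lt (by omega)] at he
      rw [he]
  rw [← hcard]
  refine h.card_mul_le S (fun y => y.2.val) (fun y => y.2) (fun y _ => rfl) ?_
  rintro ⟨p, b⟩ _ ⟨p', b'⟩ hy' ⟨m, hm, rfl⟩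
  have h1 := hmem _ hy'
  have h2 := lt_of_mem_knownOffsets hm
  have h3 := (knownOffsets_bounds hm).2
  rw [sum_rotate] at h3
  simp only [rotate, zero_add] at h1 h2 ⊢
  have hb := ZMod.val_lt b
  rw [ZMod.val_add, ZMod.val_natCast_of_lt (by omega)] at h1 ⊢
  -- A known file of column `p'` has offset `m > a (p' - 1)`: without wrapping around it leaves `S`,
  -- and with wrapping its row is below `b` because `m < K`.
  by_contra hcon
  rcases lt_or_ge (b.val + m) K with h4 | h4
  · rw [Nat.mod_eq_of_lt h4] at h1
    omega
  · rw [Nat.mod_eq_sub_mod h4, Nat.mod_eq_of_lt (by omega)] at hcon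
    omega

/-! ### The Reed–Solomon code for one nonzero entry -/

/-- If `a_1 = ⋯ = a_{i-1} = 0`, a file in column `q + 1` is known unless its offset lies in the only
chunk of interfering files, which begins after the first `q` chunks of known files. -/
theorem mem_knownOffsets_of_eq_zero {i L m : ℕ} [NeZero i] {a : ZMod i → ℕ}
    (ha : ∀ j : ZMod i, j ≠ 0 → a j = 0) (q : ZMod i) (h0 : 0 < m)
    (hm : m ≤ q.val * L ∨ q.val * L + a 0 < m ∧ m ≤ (i - 1) * L + a 0) :
    m ∈ knownOffsets i L (rotate a q) := by
  have hq := ZMod.val_lt q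
  have hsum : ∀ v ≤ i - 1, ∑ j ∈ Finset.Icc 1 v, rotate a q (1 - (j : ZMod i)) =
      if q.val + 1 ≤ v then a 0 else 0 := by
    intro v hv
    have hz : ∀ j ∈ Finset.Icc 1 v, j ≠ q.val + 1 → rotate a q (1 - (j : ZMod i)) = 0 := by
      intro j hj hne
      rw [Finset.mem_Icc] at hj
      refine ha _ fun h => hne ?_
      have h1 : ((j : ℕ) : ZMod i) = ((q.val + 1 : ℕ) : ZMod i) := by
        push_cast
        rw [ZMod.natCast_zmod_val]
        linear_combination -h
      rw [ZMod.natCast_eq_natCast_iff'] at h1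
      rw [Nat.mod_eq_of_lt (by omega)] at h1
      -- If `q.val + 1 = i`, the residue is `0`, which no `j` in `1, …, i - 1` attains.
      rcases lt_or_eq_of_le (Nat.succ_le_of_lt hq) with h2 | h2
      · rwa [Nat.mod_eq_of_lt h2] at h1
      · rw [Nat.succ_eq_add_one] at h2
        rw [h2, Nat.mod_self] at h1
        omega
    split_ifs with hqv
    · rw [Finset.sum_eq_single_of_mem (q.val + 1) (Finset.mem_Icc.2 ⟨by omega, hqv⟩) hz]
      simp [rotate]
    · exact Finset.sum_eq_zero fun j hj => hz j hj (by have := Finset.mem_Icc.1 hj; omega)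
  have hdecomp : ∀ t A B : ℕ, A * L ≤ t → t < B * L →
      ∃ v r, A ≤ v ∧ v < B ∧ r < L ∧ v * L + r = t := by
    intro t A B h1 h2
    have hL : 0 < L := Nat.pos_of_ne_zero fun h => by simp [h] at h2
    exact ⟨t / L, t % L, (Nat.le_div_iff_mul_le hL).2 h1, (Nat.div_lt_iff_lt_mul hL).2 h2, Nat.mod_lt _ hL,
      Nat.div_add_mod' t L⟩
  rcases hm with hm | ⟨hm, hm'⟩
  · obtain ⟨v, r, -, h2, h3, h4⟩ := hdecomp (m - 1) 0 q.val (by simp) (by omega)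
    refine ⟨v + 1, Finset.mem_Icc.2 ⟨by omega, by omega⟩, r + 1,
      Finset.mem_Icc.2 ⟨by omega, by omega⟩, ?_⟩
    rw [hsum _ (by omega), if_neg (by omega), Nat.add_sub_cancel]
    omega
  · obtain ⟨v, r, h1, h2, h3, h4⟩ :=
      hdecomp (m - a 0 - 1) q.val (i - 1) (by omega) (by omega)
    refine ⟨v + 1, Finset.mem_Icc.2 ⟨by omega, by omega⟩, r + 1,
      Finset.mem_Icc.2 ⟨by omega, by omega⟩, ?_⟩
    rw [hsum _ (by omega), if_pos (by omega), Nat.add_sub_cancel]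
    omega

/-- The code for `a_1 = ⋯ = a_{i-1} = 0`: column `q + 1` uses the points of a Reed–Solomon code,
shifted by `qL`, so that the interference of all columns falls into the same subspace. -/
theorem hasCode_cyclicUnion_of_eq_zero {i L K : ℕ} [NeZero i] (hL : 1 ≤ L) {a : ZMod i → ℕ}
    (hK : (i - 1) * L + ∑ j, a j + 1 = K) (ha : ∀ j : ZMod i, j ≠ 0 → a j = 0) {F : ℕ}
    (hF : K ≤ F) : (cyclicUnion i L K a hK).HasCode F ((∑ j, a j + i) * F) := by
  classical
  have hK0 : NeZero K := ⟨by omega⟩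
  have hi : 0 < i := Nat.pos_of_ne_zero (NeZero.ne i)
  have hsum : ∑ j, a j = a 0 := Fintype.sum_eq_single 0 ha
  rw [hsum] at hK ⊢
  have : Fintype (GaloisField 2 F) := Fintype.ofFinite _
  have hcard : Nat.card (GaloisField 2 F) = 2 ^ F := GaloisField.card 2 F (by omega)
  obtain ⟨α⟩ : Nonempty (ZMod K ↪ GaloisField 2 F) := by
    refine Function.Embedding.nonempty_of_card_le ?_
    rw [← Nat.card_eq_fintype_card (α := GaloisField 2 F), hcard, ZMod.card]
    exact hF.trans Nat.lt_two_pow_self.le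
  let σ : ZMod i → ZMod K := fun p => (((p - 1).val * L : ℕ) : ZMod K)
  have hσlt : ∀ p, (p - 1 : ZMod i).val * L < K := fun p => by
    have h1 : (p - 1 : ZMod i).val * L ≤ (i - 1) * L :=
      Nat.mul_le_mul_right _ (by have := ZMod.val_lt (p - 1 : ZMod i); omega)
    omega
  have hσ : Function.Injective σ := by
    intro p p' h
    have h := congrArg ZMod.val h
    simp only [σ] at h
    rw [ZMod.val_natCast_of_lt (hσlt p), ZMod.val_natCast_of_lt (hσlt p')] at h
    exact sub_left_injective (ZMod.val_injective i (Nat.eq_of_mul_eq_mul_right hL h))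
  have hlin := (cyclicUnion i L K a (by rwa [hsum])).hasCode_of_linear (ι := Fin (a 0 + i)) hcard
    (fun y j => α (y.2 - σ y.1) ^ (j : ℕ)) ?_
  · simpa using hlin
  intro k z hz h0
  have hknown : ∀ p c, c + σ p ≠ k → (∀ m ∈ Finset.Icc 1 (a 0), c ≠ k + (m : ZMod K)) →
      z (p, c + σ p) = 0 := by
    intro p c hk hc
    refine hz _ ?_
    have hlt := ZMod.val_lt (c + σ p - k)
    refine ⟨(c + σ p - k).val, mem_knownOffsets_of_eq_zero ha _ ?_ ?_, ?_⟩
    · exact Nat.pos_of_ne_zero fun h => hk (sub_eq_zero.1 ((ZMod.val_eq_zero _).1 h))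
    · by_contra hcon
      push Not at hcon
      change (p - 1).val * L < _ ∧ ((p - 1).val * L + a 0 < _ → _) at hcon
      obtain ⟨h1, h2⟩ := hcon
      have h3 : (c + σ p - k).val ≤ (p - 1).val * L + a 0 := by
        by_contra h3
        have := h2 (by omega)
        omega
      refine hc ((c + σ p - k).val - (p - 1).val * L) (Finset.mem_Icc.2 ⟨by omega, by omega⟩) ?_
      rw [Nat.cast_sub h1.le, ZMod.natCast_zmod_val]
      simp only [σ]
      ring
    · change c + σ p = _
      rw [ZMod.natCast_zmod_val]
      ring
  -- Files sharing a point add up; `S` consists of the common interference and the `i` wanted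
  -- points.
  let w : ZMod K → GaloisField 2 F := fun c => ∑ p, z (p, c + σ p)
  let S : Finset (ZMod K) := (Finset.Icc 1 (a 0)).image (fun m : ℕ => k + (m : ZMod K)) ∪
    Finset.univ.image fun p => k - σ p
  have hw : w = 0 := by
    refine eq_zero_of_forall_sum_mul_pow (R := a 0 + i) α α.injective w S ?_ ?_ ?_
    · refine (Finset.card_union_le _ _).trans (Nat.add_le_add ?_ ?_)
      · exact Finset.card_image_le.trans (by simp)
      · exact Finset.card_image_le.trans (by simp [ZMod.card])
    · intro c hc
      simp only [S, Finset.mem_union, Finset.mem_image, not_or, not_exists, not_and,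
        Finset.mem_univ, true_and] at hc
      refine Finset.sum_eq_zero fun p _ => hknown p c (fun h => hc.2 p ?_)
        fun m hm h => hc.1 m hm h.symm
      rw [← h, add_sub_cancel_right]
    · intro j hj
      rw [← h0 ⟨j, hj⟩, Fintype.sum_prod_type]
      simp only [w, Finset.sum_mul]
      rw [Finset.sum_comm]
      refine Finset.sum_congr rfl fun p _ => ?_
      exact Fintype.sum_equiv (Equiv.addRight (σ p)) _ _ fun c => by simp
  rintro ⟨p, b⟩ hb
  obtain rfl : b = k := hb
  have hnot : ∀ m ∈ Finset.Icc 1 (a 0), b - σ p ≠ b + (m : ZMod K) := by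
    intro m hm h
    rw [Finset.mem_Icc] at hm
    have h1 : (((p - 1).val * L + m : ℕ) : ZMod K) = 0 := by
      rw [Nat.cast_add]
      linear_combination -h
    rw [ZMod.natCast_eq_zero_iff] at h1
    have h2 := Nat.le_of_dvd (by omega) h1
    have h3 : (p - 1 : ZMod i).val * L ≤ (i - 1) * L :=
      Nat.mul_le_mul_right _ (by have := ZMod.val_lt (p - 1 : ZMod i); omega)
    omega
  -- At this point every other column contributes a known file, so the wanted one is isolated.
  have hwp : w (b - σ p) = 0 := congrFun hw _
  simp only [w] at hwp
  rw [Fintype.sum_eq_single p] at hwp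
  · simpa using hwp
  · intro q hq
    refine hknown q _ (fun h => hq (hσ ?_)) hnot
    linear_combination h

/-! ### The clique code for `L = 1` -/

/-- For `L = 1` the files fall into `K` groups of `i` files such that every user wanting a file of a
group knows the other files of that group; the code sends the sum of each group. -/
theorem hasCode_cyclicUnion_one {i K : ℕ} [NeZero i] {a : ZMod i → ℕ}
    (hK : (i - 1) * 1 + ∑ j, a j + 1 = K) {F : ℕ} (hF : F ≠ 0) :
    (cyclicUnion i 1 K a hK).HasCode F (K * F) := by
  classical
  have hK0 : NeZero K := ⟨by omega⟩
  have hi : 0 < i := Nat.pos_of_ne_zero (NeZero.ne i)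
  let T : ZMod i → ZMod K := fun p => ∑ j ∈ Finset.range p.val, ((a (j : ZMod i) : ZMod K) + 1)
  -- A full turn is `∑ j, a j + i = K`, so `T` is consistent modulo `i`.
  have htot : ∑ j ∈ Finset.range i, ((a (j : ZMod i) : ZMod K) + 1) = 0 := by
    have h1 : ∑ j ∈ Finset.range i, a (j : ZMod i) = ∑ j, a j := by
      refine Finset.sum_bij' (fun j _ => (j : ZMod i)) (fun j _ => j.val) (by simp)
        (fun j _ => Finset.mem_range.2 (ZMod.val_lt j)) (fun j hj => ?_) (by simp) (by simp)
      exact ZMod.val_natCast_of_lt (Finset.mem_range.1 hj)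
    rw [Finset.sum_add_distrib, ← Nat.cast_sum, h1]
    have h2 : ((∑ j, a j + i : ℕ) : ZMod K) = 0 := by
      rw [ZMod.natCast_eq_zero_iff, ← hK]
      exact dvd_of_eq (by omega)
    simpa using h2
  have hstep : ∀ p : ZMod i, T (p + 1) = T p + (a p + 1) := by
    intro p
    have hp : ((p.val : ℕ) : ZMod i) = p := ZMod.natCast_zmod_val p
    have hs := Finset.sum_range_succ (fun j : ℕ => (a (j : ZMod i) : ZMod K) + 1) p.val
    rw [hp] at hs
    simp only [T]
    rw [← hs]
    have hv := ZMod.val_lt p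
    have hp1 : p + 1 = ((p.val + 1 : ℕ) : ZMod i) := by rw [Nat.cast_add, hp, Nat.cast_one]
    rw [hp1, ZMod.val_natCast]
    rcases lt_or_eq_of_le (Nat.succ_le_of_lt hv) with h | h
    · rw [Nat.mod_eq_of_lt h]
    · rw [Nat.succ_eq_add_one] at h
      rw [h, Nat.mod_self, htot, Finset.sum_range_zero]
  have hoff : ∀ (q : ZMod i) (v : ℕ),
      ((∑ j ∈ Finset.Icc 1 v, rotate a (q - 1) (1 - (j : ZMod i)) + v : ℕ) : ZMod K) =
        T q - T (q - v) := by
    intro q v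
    induction v with
    | zero => simp
    | succ v ih =>
      have h1 := hstep (q - (v + 1 : ℕ))
      have h2 : q - ((v + 1 : ℕ) : ZMod i) + 1 = q - v := by push_cast; ring
      have h3 : rotate a (q - 1) (1 - ((v + 1 : ℕ) : ZMod i)) = a (q - (v + 1 : ℕ)) := by
        simp only [rotate]
        congr 1
        ring
      rw [h2] at h1
      rw [Finset.sum_Icc_succ_top (by omega), h3]
      push_cast at ih h1 ⊢
      linear_combination ih - h1
  have hlin := (cyclicUnion i 1 K a hK).hasCode_of_linear (ι := ZMod K)
    (GaloisField.card 2 F hF) (fun y c => if y.2 = c + T y.1 then 1 else 0) ?_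
  · simpa [ZMod.card] using hlin
  rintro k z hz h0 ⟨p, b⟩ hb
  obtain rfl : b = k := hb
  have h1 := h0 (b - T p)
  simp only [mul_ite, mul_one, mul_zero, Fintype.sum_prod_type, Finset.sum_ite_eq',
    Finset.mem_univ, if_true] at h1
  rw [Fintype.sum_eq_single p] at h1
  · simpa using h1
  · intro q hq
    refine hz _ ?_
    have hpos : (q - p).val ≠ 0 := fun h =>
      hq (sub_eq_zero.1 ((ZMod.val_eq_zero _).1 h))
    have hlt := ZMod.val_lt (q - p)
    -- From column `p` to column `q`, the offset `T q - T p` ends chunk number `(q - p).val`, whose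
    -- only known file is `r = 1`.
    refine ⟨_, ⟨(q - p).val, Finset.mem_Icc.2 ⟨by omega, by omega⟩, 1, by simp, rfl⟩, ?_⟩
    have h2 := hoff q (q - p).val
    rw [ZMod.natCast_zmod_val, sub_sub_cancel] at h2
    rw [mul_one, add_assoc, Nat.sub_add_cancel (by omega), h2]
    change b - T p + T q = _
    ring

end IndexCodingProblem

open IndexCodingProblem in
theorem corollary4 (i L K : ℕ) [NeZero i] (hL : 1 ≤ L) (a : ZMod i → ℕ)
    (hK : (i - 1) * L + ∑ j, a j + 1 = K) :
    ((∀ j : ZMod i, j ≠ 0 → a j = 0) →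
      (cyclicUnion i L K a hK).optimalRate = (K : ℝ) - ((i : ℝ) - 1) * L + i - 1 ∧
      ∀ᶠ F : ℕ in atTop, IsLeast ((cyclicUnion i L K a hK).achievableRates F)
        ((K : ℝ) - ((i : ℝ) - 1) * L + i - 1)) ∧
    (L = 1 →
      (cyclicUnion i L K a hK).optimalRate = (K : ℝ) ∧
      ∀ᶠ F : ℕ in atTop, IsLeast ((cyclicUnion i L K a hK).achievableRates F) (K : ℝ)) := by
  have hi : 1 ≤ i := Nat.one_le_iff_ne_zero.2 (NeZero.ne i)
  refine ⟨fun ha => ?_, fun h1 => ?_⟩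
  · have hR : (K : ℝ) - ((i : ℝ) - 1) * L + i - 1 = ((∑ j, a j + i : ℕ) : ℝ) := by
      rw [← hK, Nat.cast_add, Nat.cast_add, Nat.cast_mul, Nat.cast_sub hi, Nat.cast_add]
      push_cast
      ring
    rw [hR]
    refine optimalRate_eq_of_bounds _ (fun F ℓ h => le_of_hasCode_cyclicUnion hK h) ?_
    filter_upwards [eventually_ge_atTop K] with F hF
    exact hasCode_cyclicUnion_of_eq_zero hL hK ha hF
  · subst h1
    have hR : K = ∑ j, a j + i := by omega
    refine optimalRate_eq_of_bounds _ (fun F ℓ h => ?_) ?_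
    · have := le_of_hasCode_cyclicUnion hK h
      rwa [← hR] at this
    · filter_upwards [eventually_ge_atTop 1] with F hF
      exact hasCode_cyclicUnion_one hK (by omega)
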